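/- Let $n\ge 1$ and let $S^{2n+1}\subset\mathbb C^{n+1}\approx\mathbb R^{2n+2}$ be the unit sphere, with coordinates $z^j=x^j+iy^j$ ($1\le j\le n+1$) on $\mathbb C^{n+1}$. Let $H$ be the maximal complex (i.e. $i$-invariant) distribution in $T(S^{2n+1})$, with complex structure $J$. Let $\theta=\sum_j(x^j\,dy^j-y^j\,dx^j)$ (restricted to the sphere) be the standard contact form, so $\mathrm{Ker}(\theta)=H$, and use the convention $2(d\theta)(X,Y)=X(\theta(Y))-Y(\theta(X))-\theta([X,Y])$. Let $G_\theta(X,Y)=(d\theta)(X,JY)$ ($X,Y\in H$) be the Levi form, let $T$ be the tangent vector field with $\theta(T)=1$ and $d\theta(T,\cdot)=0$, and let $g_\theta$ be the Webster metric: $g_\theta=G_\theta$ on $H$, $g_\theta(X,T)=0$ for $X\in H$, $g_\theta(T,T)=1$. The sublaplacian is $\Delta_b f=\mathrm{div}(\nabla^H f)$, where $\nabla^H f$ is the projection of the $g_\theta$-gradient of $f$ to $H$ along $\mathbb R T$ and $\mathrm{div}$ is the divergence of the Riemannian metric $g_\theta$. Let $\mathrm{Eigen}(\Delta_b;\mu)=\{f\in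 C^\infty(S^{2n+1},\mathbb R):\Delta_b f=\mu f\}$, and let $\mathrm{Spec}(\Delta_b)$ be the set of eigenvalues of $\Delta_b$, i.e. of all $\mu\in\mathbb R$ with $\mathrm{Eigen}(\Delta_b;\mu)\ne(0)$. Let $\mathcal P_\ell$ be the space of homogeneous real polynomials of degree $\ell$ on $\mathbb R^{2n+2}$ (including $0$), let $\mathcal H_\ell\subset\mathcal P_\ell$ be the subspace of harmonic ones, and let $T_0=\sum_j\left(x^j\,\frac{\partial}{\partial y^j}-y^j\,\frac{\partial}{\partial x^j}\right)$. **Proposition.** For every integer $\ell\ge 0$ and every $\lambda\in\mathbb R$, if $\mathcal H_\ell\cap\mathrm{Ker}(T_0^2+\lambda I)\neq(0)$, then $\lambda-\ell(2n+\ell)\in\mathrm{Spec}(\Delta_b)$. In particular $\{-2n,\,-4n,\,-6n-8,\,-6n\}\subset\mathrm{Spec}(\Delta_b)$. Moreover, identifying polynomials with their restrictions to $S^{2n+1}$, one has $\mathrm{Eigen}(\Delta_b;-2n)\cap\mathcal P_1\neq(0)$, $\mathrm{Eigen}(\Delta_b;-4n)\cap\mathcal P_2\neq(0)$, and $\mathrm{Eigen}(\Delta_b;\mu)\cap\mathcal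 P_3\neq(0)$ for each $\mu\in\{-6n-8,\,-6n\}$. -/

import Mathlib

open Manifold ContDiff Metric

noncomputable section

namespace CRSphere

/-! ### The ambient space and the sphere -/

/-- The space `ℂ^{n+1} ≈ ℝ^{2n+2}` with its Euclidean structure. For `u : Amb n` the real
coordinates are `x^j = u (Sum.inl j)` and `y^j = u (Sum.inr j)`, so that `z^j = x^j + i y^j`. -/
abbrev Amb (n : ℕ) : Type := EuclideanSpace ℝ (Fin (n + 1) ⊕ Fin (n + 1))

instance finrankAmb (n : ℕ) : Fact (Module.finrank ℝ (Amb n) = 2 * n + 1 + 1) :=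
  ⟨by simp [Amb]; ring⟩

/-- The unit sphere `S^{2n+1} ⊆ ℂ^{n+1}`, with the smooth structure given by Mathlib. -/
abbrev Sph (n : ℕ) : Type := sphere (0 : Amb n) 1

/-- The tangent space `T_p(S^{2n+1})`. -/
abbrev Tan {n : ℕ} (p : Sph n) : Type := TangentSpace (𝓡 (2 * n + 1)) p

/-- The differential `d_p ι : T_p(S^{2n+1}) → ℂ^{n+1}` of the inclusion `ι`. -/
def dIncl {n : ℕ} (p : Sph n) : Tan p →ₗ[ℝ] Amb n :=
  (mvfderiv (𝓡 (2 * n + 1)) ((↑) : Sph n → Amb n) p).toLinearMap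

/-- Multiplication by `i` on `ℂ^{n+1}`: `∂/∂x^j ↦ ∂/∂y^j`, `∂/∂y^j ↦ -∂/∂x^j`. -/
def ambJ (n : ℕ) : Amb n →L[ℝ] Amb n :=
  LinearMap.toContinuousLinearMap
    { toFun := fun u => WithLp.toLp 2
        (Sum.elim (fun j => -u (Sum.inr j)) (fun j => u (Sum.inl j)))
      map_add' := by
        intro u v
        ext i
        rcases i with i | i
        · simp; ring
        · simp
      map_smul' := by
        intro c u
        ext i
        rcases i with i | i <;> simp }

/-! ### The CR structure, the contact form and the Levi form -/

/-- The `1`-form `(i/2) (∂̄ - ∂) |z|² = ∑ⱼ (x^j dy^j - y^j dx^j)` on `ℂ^{n+1}`. -/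
def ambTheta (n : ℕ) (z : Amb n) : Amb n [⋀^Fin 1]→L[ℝ] ℝ :=
  ContinuousAlternatingMap.ofSubsingleton ℝ (Amb n) ℝ (0 : Fin 1)
    (∑ j : Fin (n + 1),
      (z (Sum.inl j) • (EuclideanSpace.proj (Sum.inr j) : Amb n →L[ℝ] ℝ)
        - z (Sum.inr j) • (EuclideanSpace.proj (Sum.inl j) : Amb n →L[ℝ] ℝ)))

/-- The standard contact form `θ` on `S^{2n+1}`, the pullback of `ambTheta` by the inclusion. -/
def theta {n : ℕ} (p : Sph n) (v : Tan p) : ℝ :=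
  ambTheta n p ![dIncl p v]

/-- The exterior derivative `dθ` on `S^{2n+1}` (pullback commutes with `d`), normalized by
`2 (dθ)(X,Y) = X(θ(Y)) - Y(θ(X)) - θ([X,Y])`, the convention for which the Webster metric of the
sphere is the metric of constant curvature one. Mathlib's `extDeriv` has no factor `2` on the left,
hence the factor `1/2` here. -/
def dTheta {n : ℕ} (p : Sph n) (v w : Tan p) : ℝ :=
  (1 / 2) * extDeriv (ambTheta n) p ![dIncl p v, dIncl p w]

/-- The maximally complex distribution: `H(S^{2n+1})_p` is the largest subspace of the tangent
space that is invariant under multiplication by `i`. -/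
def leviDist {n : ℕ} (p : Sph n) : Submodule ℝ (Tan p) :=
  (LinearMap.range (dIncl p)).comap ((ambJ n).toLinearMap ∘ₗ dIncl p)

theorem dIncl_injective {n : ℕ} (p : Sph n) : Function.Injective (dIncl p) :=
  injective_mvfderiv_subtypeVal_sphere p

/-- The complex structure `J` of `H(S^{2n+1})_p` (with values in the tangent space): `J Y` is the
tangent vector with `dι (J Y) = i · dι Y`. -/
def crJ {n : ℕ} (p : Sph n) (Y : leviDist p) : Tan p :=
  (LinearEquiv.ofInjective (dIncl p) (dIncl_injective p)).symm ⟨ambJ n (dIncl p Y), Y.2⟩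

/-- The Levi form `G_θ(X,Y) = (dθ)(X, J Y)`, for `X, Y ∈ H(S^{2n+1})`. -/
def leviForm {n : ℕ} (p : Sph n) (X Y : leviDist p) : ℝ :=
  dTheta p X (crJ p Y)

/-! ### Facts needed for the characteristic direction and the gradient -/

open scoped RealInnerProductSpace

theorem mem_range_dIncl {n : ℕ} (p : Sph n) (u : Amb n) :
    u ∈ LinearMap.range (dIncl p) ↔ ⟪(p : Amb n), u⟫ = 0 := by
  have h := range_mvfderiv_subtypeVal (n := 2 * n + 1) p
  rw [← Submodule.mem_orthogonal_singleton_iff_inner_right, ← h]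
  rfl

theorem ambJ_inl {n : ℕ} (u : Amb n) (j : Fin (n + 1)) :
    ambJ n u (Sum.inl j) = -u (Sum.inr j) := rfl

theorem ambJ_inr {n : ℕ} (u : Amb n) (j : Fin (n + 1)) :
    ambJ n u (Sum.inr j) = u (Sum.inl j) := rfl

theorem ambJ_ambJ {n : ℕ} (u : Amb n) : ambJ n (ambJ n u) = -u := by
  ext i
  rcases i with i | i
  · rw [ambJ_inl, ambJ_inr]; rfl
  · rw [ambJ_inr, ambJ_inl]; rfl

theorem inner_ambJ {n : ℕ} (u v : Amb n) : ⟪ambJ n u, v⟫ = -⟪u, ambJ n v⟫ := by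
  simp only [PiLp.inner_apply, Fintype.sum_sum_type, ambJ_inl, ambJ_inr]
  simp [Finset.sum_neg_distrib]

theorem inner_ambJ_ambJ {n : ℕ} (u v : Amb n) : ⟪ambJ n u, ambJ n v⟫ = ⟪u, v⟫ := by
  rw [inner_ambJ, ambJ_ambJ, inner_neg_right, neg_neg]

theorem inner_ambJ_self {n : ℕ} (u : Amb n) : ⟪ambJ n u, u⟫ = 0 := by
  have h := inner_ambJ u u
  rw [real_inner_comm (ambJ n u) u] at h
  linarith

theorem inner_self_sph {n : ℕ} (p : Sph n) : ⟪(p : Amb n), p⟫ = 1 := by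
  rw [real_inner_self_eq_norm_sq, norm_eq_of_mem_sphere]; norm_num

theorem ambTheta_eq {n : ℕ} (z : Amb n) :
    ambTheta n z = ContinuousAlternatingMap.ofSubsingleton ℝ (Amb n) ℝ (0 : Fin 1)
      (innerSL ℝ (ambJ n z)) := by
  unfold ambTheta
  congr 1
  ext v
  simp only [innerSL_apply_apply, PiLp.inner_apply, Fintype.sum_sum_type, ambJ_inl, ambJ_inr]
  simp only [sum_apply, sub_apply, smul_apply,
    smul_eq_mul, RCLike.inner_apply, conj_trivial, ← Finset.sum_add_distrib]
  refine Finset.sum_congr rfl fun j _ => ?_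
  change z (Sum.inl j) * v (Sum.inr j) - z (Sum.inr j) * v (Sum.inl j) = _
  ring

theorem theta_eq {n : ℕ} (p : Sph n) (v : Tan p) :
    theta p v = ⟪ambJ n p, dIncl p v⟫ := by
  simp [theta, ambTheta_eq]

theorem differentiableAt_ambTheta {n : ℕ} (z : Amb n) : DifferentiableAt ℝ (ambTheta n) z := by
  have h : ambTheta n = fun z => ContinuousAlternatingMap.ofSubsingletonLIE (𝕜 := ℝ) (E := Amb n) (F := ℝ) (0 : Fin 1)
      (innerSL ℝ (ambJ n z)) := by
    funext z
    rw [ambTheta_eq]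
    rfl
  rw [h]
  exact (ContinuousAlternatingMap.ofSubsingletonLIE (𝕜 := ℝ) (E := Amb n) (F := ℝ)
    (0 : Fin 1)).toContinuousLinearEquiv.differentiableAt.comp z
      ((innerSL ℝ).differentiableAt.comp z (ambJ n).differentiableAt)

theorem dTheta_eq {n : ℕ} (p : Sph n) (v w : Tan p) :
    dTheta p v w = ⟪ambJ n (dIncl p v), dIncl p w⟫ := by
  have hf : ∀ u x : Amb n, fderiv ℝ (fun z : Amb n => ⟪ambJ n z, u⟫) x
      = (innerSL ℝ u).comp (ambJ n) := by
    intro u x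
    have : (fun z : Amb n => ⟪ambJ n z, u⟫) = (innerSL ℝ u).comp (ambJ n) := by
      funext z
      simp [real_inner_comm]
    rw [this]
    exact ContinuousLinearMap.fderiv _
  have hv : ∀ (u : Fin 1 → Amb n), (fun z : Amb n => ambTheta n z u)
      = fun z => ⟪ambJ n z, u 0⟫ := by
    intro u
    funext z
    simp [ambTheta_eq]
  rw [dTheta, extDeriv_apply (differentiableAt_ambTheta _)]
  simp only [hv, hf]
  have h2 := inner_ambJ (dIncl p w) (dIncl p v)
  have h3 := real_inner_comm (dIncl p w) (ambJ n (dIncl p v))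
  simp [Fin.removeNth]
  rw [real_inner_comm, real_inner_comm (ambJ n (dIncl p w))]
  linarith

theorem dIncl_crJ {n : ℕ} (p : Sph n) (Y : leviDist p) :
    dIncl p (crJ p Y) = ambJ n (dIncl p Y) := by
  have h := LinearEquiv.apply_symm_apply (LinearEquiv.ofInjective (dIncl p) (dIncl_injective p))
    ⟨ambJ n (dIncl p Y), Y.2⟩
  exact congrArg Subtype.val h

theorem leviForm_eq {n : ℕ} (p : Sph n) (X Y : leviDist p) :
    leviForm p X Y = ⟪dIncl p X, dIncl p Y⟫ := by
  rw [leviForm, dTheta_eq, dIncl_crJ, inner_ambJ_ambJ]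

/-- `Ker(θ) = H(S^{2n+1})`. -/
theorem mem_leviDist_iff {n : ℕ} (p : Sph n) (v : Tan p) : v ∈ leviDist p ↔ theta p v = 0 := by
  rw [theta_eq, inner_ambJ, neg_eq_zero, ← mem_range_dIncl]
  rfl

theorem inner_dIncl {n : ℕ} (p : Sph n) (v : Tan p) : ⟪(p : Amb n), dIncl p v⟫ = 0 :=
  (mem_range_dIncl p _).1 ⟨v, rfl⟩

theorem theta_dTheta_iff {n : ℕ} (p : Sph n) (T : Tan p) :
    (theta p T = 1 ∧ ∀ v, dTheta p T v = 0) ↔ dIncl p T = ambJ n p := by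
  constructor
  · rintro ⟨h1, h2⟩
    rw [theta_eq] at h1
    set u := ambJ n (dIncl p T) with hu
    have ht : u - ⟪(p : Amb n), u⟫ • (p : Amb n) ∈ LinearMap.range (dIncl p) := by
      rw [mem_range_dIncl, inner_sub_right, inner_smul_right, inner_self_sph]; ring
    obtain ⟨v, hv⟩ := ht
    have h3 := h2 v
    rw [dTheta_eq, ← hu] at h3
    have hz : dIncl p v = 0 := by
      rw [← inner_self_eq_zero (𝕜 := ℝ)]
      nth_rw 1 [hv]
      rw [inner_sub_left, inner_smul_left, h3, inner_dIncl]; simp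
    rw [hz] at hv
    have hpu : ⟪(p : Amb n), u⟫ = -1 := by
      have := inner_ambJ (p : Amb n) (dIncl p T)
      rw [← hu] at this
      linarith
    rw [hpu] at hv
    have hu' : u = -(p : Amb n) := by
      have := sub_eq_zero.1 hv.symm
      simpa using this
    have h4 : ambJ n u = - dIncl p T := ambJ_ambJ _
    rw [hu', map_neg] at h4
    exact (neg_injective h4).symm
  · intro h
    refine ⟨?_, fun v => ?_⟩
    · rw [theta_eq, h, inner_ambJ_ambJ, inner_self_sph]
    · rw [dTheta_eq, h, ambJ_ambJ, inner_neg_left, inner_dIncl, neg_zero]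

/-- The characteristic direction of `dθ` exists and is unique. -/
theorem existsUnique_reeb {n : ℕ} (p : Sph n) :
    ∃! T : Tan p, theta p T = 1 ∧ ∀ v, dTheta p T v = 0 := by
  obtain ⟨T, hT⟩ := (mem_range_dIncl p (ambJ n p)).2
    (by rw [real_inner_comm]; exact inner_ambJ_self _)
  refine ⟨T, (theta_dTheta_iff p T).2 hT, fun T' hT' => ?_⟩
  exact dIncl_injective p (((theta_dTheta_iff p T').1 hT').trans hT.symm)

/-! ### The characteristic direction, the Webster metric and the horizontal gradient -/

/-- The characteristic direction `T` of `dθ`: `θ(T) = 1` and `T ⌟ dθ = 0`. -/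
def reeb {n : ℕ} (p : Sph n) : Tan p := (existsUnique_reeb p).choose

theorem reeb_spec {n : ℕ} (p : Sph n) :
    theta p (reeb p) = 1 ∧ ∀ v, dTheta p (reeb p) v = 0 :=
  (existsUnique_reeb p).choose_spec.1

theorem dIncl_reeb {n : ℕ} (p : Sph n) : dIncl p (reeb p) = ambJ n p :=
  (theta_dTheta_iff p _).1 (reeb_spec p)

/-- The projection `π_H : T(S^{2n+1}) → H(S^{2n+1})` associated with the direct sum decomposition
`T(S^{2n+1}) = H(S^{2n+1}) ⊕ ℝ T`. -/
def projH {n : ℕ} (p : Sph n) (v : Tan p) : leviDist p :=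
  ⟨v - theta p v • reeb p, by
    rw [mem_leviDist_iff, theta_eq, map_sub, map_smul, inner_sub_right, inner_smul_right,
      dIncl_reeb, inner_ambJ_ambJ, inner_self_sph, theta_eq]
    ring⟩

/-- The Webster metric `g_θ`: it agrees with `G_θ` on `H(S^{2n+1})`, it makes `H(S^{2n+1})` and `T`
orthogonal, and `g_θ(T,T) = 1`. -/
def webster {n : ℕ} (p : Sph n) (v w : Tan p) : ℝ :=
  leviForm p (projH p v) (projH p w) + theta p v * theta p w

theorem webster_eq {n : ℕ} (p : Sph n) (v w : Tan p) :
    webster p v w = ⟪dIncl p v, dIncl p w⟫ := by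
  rw [webster, leviForm_eq]
  simp only [projH, map_sub, map_smul, inner_sub_left, inner_sub_right, inner_smul_left,
    inner_smul_right, dIncl_reeb, inner_ambJ_ambJ, inner_self_sph, theta_eq,
    real_inner_comm (ambJ n p) (dIncl p v)]
  simp

/-- The differential of a function `f` on `S^{2n+1}`. -/
def dFun {n : ℕ} (f : Sph n → ℝ) (p : Sph n) : Tan p →ₗ[ℝ] ℝ :=
  (mvfderiv (𝓡 (2 * n + 1)) f p).toLinearMap

/-- The gradient of a function with respect to `g_θ` exists and is unique. -/
theorem existsUnique_grad {n : ℕ} (f : Sph n → ℝ) (p : Sph n) :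
    ∃! Z : Tan p, ∀ v : Tan p, webster p Z v = dFun f p v := by
  have : FiniteDimensional ℝ (Tan p) :=
    inferInstanceAs (FiniteDimensional ℝ (EuclideanSpace ℝ (Fin (2 * n + 1))))
  let B : LinearMap.BilinForm ℝ (Tan p) := (innerₗ (Amb n)).compl₁₂ (dIncl p) (dIncl p)
  have hB : ∀ v w, B v w = webster p v w := fun v w => by rw [webster_eq]; rfl
  have hnd : B.Nondegenerate := by
    have hz : ∀ v, B v v = 0 → v = 0 := fun v hv => by
      rw [hB, webster_eq, inner_self_eq_zero] at hv
      exact dIncl_injective p (hv.trans (map_zero _).symm)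
    exact ⟨fun v hv => hz v (hv v), fun v hv => hz v (hv v)⟩
  refine ⟨(B.toDual hnd).symm (dFun f p), fun v => ?_, fun Z hZ => ?_⟩
  · rw [← hB]
    exact LinearMap.BilinForm.apply_toDual_symm_apply (hB := hnd) (dFun f p) v
  · rw [LinearEquiv.eq_symm_apply]
    ext v
    rw [LinearMap.BilinForm.toDual_def, hB, hZ]

/-- The gradient `∇f`: `g_θ(∇f, X) = X(f)` for every tangent vector `X`. -/
def grad {n : ℕ} (f : Sph n → ℝ) (p : Sph n) : Tan p := (existsUnique_grad f p).choose

theorem webster_grad {n : ℕ} (f : Sph n → ℝ) (p : Sph n) (v : Tan p) :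
    webster p (grad f p) v = dFun f p v :=
  (existsUnique_grad f p).choose_spec.1 v

/-- The horizontal gradient `∇^H f = π_H ∇f`. -/
def gradH {n : ℕ} (f : Sph n → ℝ) (p : Sph n) : Tan p := projH p (grad f p)

/-! ### Divergence with respect to a metric, and the sublaplacian -/

section Divergence

variable {m : ℕ} {M : Type*} [TopologicalSpace M] [ChartedSpace (EuclideanSpace ℝ (Fin m)) M]

/-- The coordinate vector field `∂/∂x^i` of the chart at `p`, at the point with coordinates `x`. -/
def coordVec (p : M) (x : EuclideanSpace ℝ (Fin m)) (i : Fin m) :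
    TangentSpace (𝓡 m) ((chartAt (EuclideanSpace ℝ (Fin m)) p).symm x) :=
  mfderiv (𝓡 m) (𝓡 m) (chartAt (EuclideanSpace ℝ (Fin m)) p).symm x (EuclideanSpace.single i 1)

/-- The component `X^i` of the vector field `X` in the chart at `p`, at the point with
coordinates `x`. -/
def coordComp (X : ∀ q : M, TangentSpace (𝓡 m) q) (p : M) (x : EuclideanSpace ℝ (Fin m))
    (i : Fin m) : ℝ :=
  (mvfderiv (𝓡 m) (chartAt (EuclideanSpace ℝ (Fin m)) p)
    ((chartAt (EuclideanSpace ℝ (Fin m)) p).symm x)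
    (X ((chartAt (EuclideanSpace ℝ (Fin m)) p).symm x))) i

/-- The volume density `√(det (g_{ij}))` of the metric `g` in the chart at `p`. -/
def volDensity (g : ∀ q : M, TangentSpace (𝓡 m) q → TangentSpace (𝓡 m) q → ℝ) (p : M)
    (x : EuclideanSpace ℝ (Fin m)) : ℝ :=
  √(Matrix.det (Matrix.of fun i j => g _ (coordVec p x i) (coordVec p x j)))

/-- The divergence `(1/√(det g)) ∑ᵢ ∂ᵢ (√(det g) X^i)` of the vector field `X` with respect to the
Riemannian metric `g`, computed at `p` in the chart at `p`. -/
def divergence (g : ∀ q : M, TangentSpace (𝓡 m) q → TangentSpace (𝓡 m) q → ℝ)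
    (X : ∀ q : M, TangentSpace (𝓡 m) q) (p : M) : ℝ :=
  (volDensity g p (chartAt (EuclideanSpace ℝ (Fin m)) p p))⁻¹ *
    ∑ i : Fin m, fderiv ℝ (fun x => volDensity g p x * coordComp X p x i)
      (chartAt (EuclideanSpace ℝ (Fin m)) p p) (EuclideanSpace.single i 1)

end Divergence

/-- The sublaplacian `Δ_b f = div(∇^H f)`, with the divergence of the Webster metric. -/
def sublaplacian (n : ℕ) (f : Sph n → ℝ) (p : Sph n) : ℝ :=
  divergence (m := 2 * n + 1) (fun q => webster q) (gradH f) p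

/-- The eigenspace `Eigen(Δ_b; μ)`: the smooth functions `f` with `Δ_b f = μ f`. -/
def eigen (n : ℕ) (μ : ℝ) : Set (Sph n → ℝ) :=
  {f | ContMDiff (𝓡 (2 * n + 1)) 𝓘(ℝ, ℝ) ∞ f ∧ ∀ p, sublaplacian n f p = μ * f p}

/-- `Spec(Δ_b)`, the set of the eigenvalues of the sublaplacian. -/
def spec (n : ℕ) : Set ℝ := {μ | ∃ f ∈ eigen n μ, f ≠ 0}

/-! ### Polynomials on `ℝ^{2n+2}` -/

/-- Real polynomials in the coordinates `x^j` (indices `Sum.inl j`) and `y^j` (indices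
`Sum.inr j`) of `ℝ^{2n+2}`. -/
abbrev Pol (n : ℕ) : Type := MvPolynomial (Fin (n + 1) ⊕ Fin (n + 1)) ℝ

/-- `𝓟_ℓ`: the homogeneous polynomials of degree `ℓ`, and the zero polynomial. -/
def homPol (n ℓ : ℕ) : Submodule ℝ (Pol n) :=
  MvPolynomial.homogeneousSubmodule (Fin (n + 1) ⊕ Fin (n + 1)) ℝ ℓ

/-- The Laplacian of `ℝ^{2n+2}` on polynomials. -/
def polLaplacian (n : ℕ) : Pol n →ₗ[ℝ] Pol n :=
  ∑ i, (MvPolynomial.pderiv i).toLinearMap ∘ₗ (MvPolynomial.pderiv i).toLinearMap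

/-- `𝓗_ℓ`: the harmonic homogeneous polynomials of degree `ℓ`, and the zero polynomial. -/
def harmPol (n ℓ : ℕ) : Submodule ℝ (Pol n) :=
  homPol n ℓ ⊓ LinearMap.ker (polLaplacian n)

/-- `T₀ = ∑ⱼ (x^j ∂/∂y^j - y^j ∂/∂x^j)` on polynomials. -/
def T₀ (n : ℕ) : Module.End ℝ (Pol n) :=
  ∑ j : Fin (n + 1),
    (LinearMap.mulLeft ℝ (MvPolynomial.X (Sum.inl j)) ∘ₗ
        (MvPolynomial.pderiv (Sum.inr j)).toLinearMap
      - LinearMap.mulLeft ℝ (MvPolynomial.X (Sum.inr j)) ∘ₗ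
        (MvPolynomial.pderiv (Sum.inl j)).toLinearMap)

/-- The restriction of a polynomial to the sphere. -/
def restrict {n : ℕ} (H : Pol n) (p : Sph n) : ℝ :=
  MvPolynomial.eval (fun i => (p : Amb n) i) H

end CRSphere

end

noncomputable section

namespace CRSphere

open scoped RealInnerProductSpace

variable {n : ℕ}

/-! ### The stereographic chart -/

/-! By `webster_eq` the Webster metric is the metric induced from the ambient Euclidean space, and
by `dIncl_reeb` the characteristic direction at `q` is `Jq`. For `P` homogeneous of degree `ℓ`,
Euler's identity gives the normal part of the Euclidean gradient `∇P`, and the component of `∇P`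
along `Jq` is `T₀ P`. So the horizontal gradient of `P` on the sphere is the restriction of the
polynomial field `Y = ∇P - ℓ P z - (T₀ P) Jz` (`dIncl_gradH_restrict`).

The divergence on the sphere of the restriction of an ambient field `Y` that is tangent along the
sphere is the trace of `DY(p)` over `p^⊥`, i.e. the Euclidean divergence minus `⟪p, DY(p) p⟫`
(`divergence_webster`, `sum_inner_tanIncl`). For the field above, the Euclidean divergence is `ΔP -
ℓ(ℓ + 2n + 2)P - T₀²P` and the normal term is `-2ℓP`. If `ΔP = 0` and `T₀²P = -λP`, what remains is
`(λ - ℓ(2n + ℓ))P` (`sublaplacian_restrict`). A nonzero homogeneous polynomial does not vanish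
identically on the sphere (`restrict_ne_zero`), so this is an eigenvalue.

The explicit eigenvalues come from `T₀ z = iz`: on real parts of monomials with `a` factors `z^j`
and `b` factors conjugate to some `z^k`, `T₀²` is `-(a - b)²`. The polynomials used are the real
parts of `z`, `z²`, `z³` and `z² w̄`, with `z`, `w` distinct coordinates. -/

/-- The orthonormal basis of `p^⊥` used by the chart at `p`. -/
def tanBasis (p : Sph n) :
    OrthonormalBasis (Fin (2 * n + 1)) ℝ (Submodule.span ℝ {((-p : Sph n) : Amb n)})ᗮ :=
  OrthonormalBasis.fromOrthogonalSpanSingleton (2 * n + 1) (ne_zero_of_mem_unit_sphere (-p))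

/-- The linear isometry of `ℝ^{2n+1}` onto `p^⊥` underlying the chart at `p`. -/
def tanIncl (p : Sph n) : EuclideanSpace ℝ (Fin (2 * n + 1)) →L[ℝ] Amb n :=
  (Submodule.span ℝ {((-p : Sph n) : Amb n)})ᗮ.subtypeL.comp
    (tanBasis p).repr.symm.toContinuousLinearEquiv.toContinuousLinearMap

theorem inner_tanIncl (p : Sph n) (x y : EuclideanSpace ℝ (Fin (2 * n + 1))) :
    ⟪tanIncl p x, tanIncl p y⟫ = ⟪x, y⟫ :=
  (tanBasis p).repr.symm.inner_map_map x y

theorem norm_tanIncl (p : Sph n) (x : EuclideanSpace ℝ (Fin (2 * n + 1))) :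
    ‖tanIncl p x‖ = ‖x‖ :=
  (tanBasis p).repr.symm.norm_map x

theorem inner_left_tanIncl (p : Sph n) (x : EuclideanSpace ℝ (Fin (2 * n + 1))) :
    ⟪(p : Amb n), tanIncl p x⟫ = 0 := by
  have h := Submodule.mem_orthogonal_singleton_iff_inner_right.1 ((tanBasis p).repr.symm x).2
  have h2 : ⟪-(p : Amb n), tanIncl p x⟫ = 0 := h
  rwa [inner_neg_left, neg_eq_zero] at h2

/-- The inverse of the chart at `p`, as a map to the ambient space. -/
def stereoParam (p : Sph n) (x : EuclideanSpace ℝ (Fin (2 * n + 1))) : Amb n :=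
  (‖x‖ ^ 2 + 4)⁻¹ • ((4 : ℝ) • tanIncl p x + (4 - ‖x‖ ^ 2) • (p : Amb n))

/-- The chart at `p` is stereographic projection from the antipode `-p`; this is why `p` sits at the
origin of the chart. -/
theorem coe_chartAt_symm (p : Sph n) (x : EuclideanSpace ℝ (Fin (2 * n + 1))) :
    (((chartAt (EuclideanSpace ℝ (Fin (2 * n + 1))) p).symm x : Sph n) : Amb n)
      = stereoParam p x := by
  have h := stereographic'_symm_apply (n := 2 * n + 1) (-p) x
  have h2 : ‖(((tanBasis p).repr.symm x : _) : Amb n)‖ = ‖x‖ := norm_tanIncl p x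
  refine h.trans ?_
  change (‖(((tanBasis p).repr.symm x : _) : Amb n)‖ ^ 2 + 4)⁻¹ • (4 : ℝ) • (tanIncl p x) +
        (‖(((tanBasis p).repr.symm x : _) : Amb n)‖ ^ 2 + 4)⁻¹ •
        (‖(((tanBasis p).repr.symm x : _) : Amb n)‖ ^ 2 - 4) • ((-p : Sph n) : Amb n) = _
  rw [h2, coe_neg_sphere, stereoParam, smul_add]
  congr 2
  rw [smul_neg, ← neg_smul, neg_sub]

theorem chartAt_self (p : Sph n) :
    chartAt (EuclideanSpace ℝ (Fin (2 * n + 1))) p p = 0 := by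
  set e := chartAt (EuclideanSpace ℝ (Fin (2 * n + 1))) p with he
  have h0 : e.symm 0 = p := by
    apply Subtype.ext
    rw [coe_chartAt_symm, stereoParam]
    simp
  have ht : (0 : EuclideanSpace ℝ (Fin (2 * n + 1))) ∈ e.target := by
    rw [he]
    change _ ∈ (stereographic' (2 * n + 1) (-p)).target
    simp
  calc e p = e (e.symm 0) := by rw [h0]
    _ = 0 := e.right_inv ht

theorem mem_chartAt_target (p : Sph n) (x : EuclideanSpace ℝ (Fin (2 * n + 1))) :
    x ∈ (chartAt (EuclideanSpace ℝ (Fin (2 * n + 1))) p).target := by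
  change _ ∈ (stereographic' (2 * n + 1) (-p)).target
  simp

/-- The differential of `stereoParam`. -/
def stereoDeriv (p : Sph n) (x h : EuclideanSpace ℝ (Fin (2 * n + 1))) : Amb n :=
  (‖x‖ ^ 2 + 4)⁻¹ • ((4 : ℝ) • tanIncl p h - (2 * ⟪x, h⟫) • (p : Amb n))
    - ((‖x‖ ^ 2 + 4)⁻¹ ^ 2 * (2 * ⟪x, h⟫)) •
      ((4 : ℝ) • tanIncl p x + (4 - ‖x‖ ^ 2) • (p : Amb n))

theorem differentiable_stereoParam (p : Sph n) : Differentiable ℝ (stereoParam p) := by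
  unfold stereoParam
  have h1 : Differentiable ℝ fun x : EuclideanSpace ℝ (Fin (2 * n + 1)) => ‖x‖ ^ 2 :=
    differentiable_id.norm_sq ℝ
  refine ((h1.add_const 4).inv fun x => by positivity).smul ?_
  exact ((tanIncl p).differentiable.const_smul (4 : ℝ)).add
    ((h1.const_sub 4).smul_const _)

theorem fderiv_stereoParam (p : Sph n) (x h : EuclideanSpace ℝ (Fin (2 * n + 1))) :
    fderiv ℝ (stereoParam p) x h = stereoDeriv p x h := by
  have h1 : HasFDerivAt (fun x : EuclideanSpace ℝ (Fin (2 * n + 1)) => ‖x‖ ^ 2)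
      (2 • innerSL ℝ x) x := (hasStrictFDerivAt_norm_sq x).hasFDerivAt
  have hne : ‖x‖ ^ 2 + 4 ≠ 0 := by positivity
  have h2 := (hasDerivAt_inv hne).comp_hasFDerivAt x (h1.add_const 4)
  have h3 := h2.fun_smul (((tanIncl p).hasFDerivAt (x := x)).const_smul (4 : ℝ) |>.add
    ((h1.const_sub 4).smul_const (p : Amb n)))
  have h4 : HasFDerivAt (stereoParam p) _ x := h3
  rw [h4.fderiv]
  simp [stereoDeriv]
  module

/-- Stereographic projection is conformal. The factor `4 / (‖x‖² + 4)` determines both the volume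
density and the components of a field in the chart. -/
theorem inner_stereoDeriv (p : Sph n) (x h k : EuclideanSpace ℝ (Fin (2 * n + 1))) :
    ⟪stereoDeriv p x h, stereoDeriv p x k⟫ = (4 * (‖x‖ ^ 2 + 4)⁻¹) ^ 2 * ⟪h, k⟫ := by
  have hp : ⟪(p : Amb n), (p : Amb n)⟫ = 1 := inner_self_sph p
  have hr : ∀ y, ⟪tanIncl p y, (p : Amb n)⟫ = 0 := fun y => by
    rw [real_inner_comm, inner_left_tanIncl]
  simp only [stereoDeriv, inner_sub_left, inner_sub_right, inner_add_left, inner_add_right,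
    real_inner_smul_left, real_inner_smul_right, inner_tanIncl, inner_left_tanIncl, hp, hr,
    real_inner_self_eq_norm_sq, real_inner_comm x h, norm_tanIncl]
  have hne : ‖x‖ ^ 2 + 4 ≠ 0 := by positivity
  field_simp
  ring

/-! ### Differentials -/

theorem mdifferentiableAt_coe (p : Sph n) :
    MDifferentiableAt (𝓡 (2 * n + 1)) 𝓘(ℝ, Amb n) ((↑) : Sph n → Amb n) p :=
  (contMDiff_coe_sphere (m := 1) p).mdifferentiableAt one_ne_zero

theorem mdifferentiableAt_chartAt_symm (p : Sph n) (x : EuclideanSpace ℝ (Fin (2 * n + 1))) :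
    MDifferentiableAt (𝓡 (2 * n + 1)) (𝓡 (2 * n + 1))
      (chartAt (EuclideanSpace ℝ (Fin (2 * n + 1))) p).symm x :=
  have : IsManifold (𝓡 (2 * n + 1)) 1 (Sph n) := .of_le (n := ω) le_top
  mdifferentiableAt_atlas_symm (chart_mem_atlas _ p) (mem_chartAt_target p x)

theorem dIncl_mfderiv_chartAt_symm (p : Sph n) (x h : EuclideanSpace ℝ (Fin (2 * n + 1))) :
    dIncl ((chartAt (EuclideanSpace ℝ (Fin (2 * n + 1))) p).symm x)
      (mfderiv (𝓡 (2 * n + 1)) (𝓡 (2 * n + 1))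
        (chartAt (EuclideanSpace ℝ (Fin (2 * n + 1))) p).symm x h) = stereoDeriv p x h := by
  rw [← fderiv_stereoParam]
  have h1 := mfderiv_comp_apply x
    (mdifferentiableAt_coe ((chartAt (EuclideanSpace ℝ (Fin (2 * n + 1))) p).symm x))
    (mdifferentiableAt_chartAt_symm p x) h
  have h2 : ((↑) : Sph n → Amb n) ∘ (chartAt (EuclideanSpace ℝ (Fin (2 * n + 1))) p).symm
      = stereoParam p := funext fun x => coe_chartAt_symm p x
  rw [h2, mfderiv_eq_fderiv] at h1
  exact h1.symm

theorem mfderiv_symm_mvfderiv {m : ℕ} {M : Type*} [TopologicalSpace M]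
    [ChartedSpace (EuclideanSpace ℝ (Fin m)) M]
    {e : OpenPartialHomeomorph M (EuclideanSpace ℝ (Fin m))} (he : e.MDifferentiable (𝓡 m) (𝓡 m))
    {x : EuclideanSpace ℝ (Fin m)} (hx : x ∈ e.target) (v : TangentSpace (𝓡 m) (e.symm x)) :
    mfderiv (𝓡 m) (𝓡 m) e.symm x (mvfderiv (𝓡 m) e (e.symm x) v) = v := by
  have h := he.symm_comp_deriv (e.map_target hx)
  rw [e.right_inv hx] at h
  exact congrArg (fun f => f v) h

theorem dFun_restrict_comp {F : Amb n → ℝ} (p : Sph n) (hF : DifferentiableAt ℝ F p)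
    (v : Tan p) : dFun (fun q : Sph n => F q) p v = fderiv ℝ F p (dIncl p v) := by
  have h1 := mfderiv_comp_apply p (g := F) (f := ((↑) : Sph n → Amb n))
    hF.mdifferentiableAt (mdifferentiableAt_coe p) v
  rw [mfderiv_eq_fderiv] at h1
  exact h1

/-! ### The divergence of a vector field -/

theorem volDensity_webster (p : Sph n) (x : EuclideanSpace ℝ (Fin (2 * n + 1))) :
    volDensity (m := 2 * n + 1) (fun q : Sph n => webster q) p x
      = (4 * (‖x‖ ^ 2 + 4)⁻¹) ^ (2 * n + 1) := by
  have h : (Matrix.of fun i j => webster _ (coordVec (m := 2 * n + 1) p x i) (coordVec p x j))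
      = (4 * (‖x‖ ^ 2 + 4)⁻¹) ^ 2 • (1 : Matrix (Fin (2 * n + 1)) (Fin (2 * n + 1)) ℝ) := by
    ext i j
    rw [Matrix.of_apply, webster_eq, coordVec, coordVec, dIncl_mfderiv_chartAt_symm,
      dIncl_mfderiv_chartAt_symm, inner_stereoDeriv]
    simp [Matrix.one_apply, EuclideanSpace.inner_single_left]
  rw [volDensity, h, Matrix.det_smul, Matrix.det_one, Fintype.card_fin, mul_one, ← pow_mul,
    pow_mul', Real.sqrt_sq (by positivity)]

theorem coordComp_eq (X : ∀ q : Sph n, Tan q) (p : Sph n)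
    (x : EuclideanSpace ℝ (Fin (2 * n + 1))) (i : Fin (2 * n + 1)) :
    coordComp X p x i = ((4 * (‖x‖ ^ 2 + 4)⁻¹) ^ 2)⁻¹ *
      ⟪stereoDeriv p x (EuclideanSpace.single i 1),
        dIncl _ (X ((chartAt (EuclideanSpace ℝ (Fin (2 * n + 1))) p).symm x))⟫ := by
  have : IsManifold (𝓡 (2 * n + 1)) 1 (Sph n) := .of_le (n := ω) le_top
  have h := mfderiv_symm_mvfderiv (mdifferentiable_chart p) (mem_chartAt_target p x)
    (X ((chartAt (EuclideanSpace ℝ (Fin (2 * n + 1))) p).symm x))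
  have h2 := congrArg (dIncl _) h
  rw [← h2, dIncl_mfderiv_chartAt_symm, inner_stereoDeriv, ← mul_assoc,
    inv_mul_cancel₀ (by positivity), one_mul]
  rw [EuclideanSpace.inner_single_left]
  simp [coordComp]

/-- At the centre of the chart the second derivative of the parametrization is purely normal: the
first derivatives of the conformal factor vanish there, and only the second fundamental form of the
sphere is left. -/
theorem hasFDerivAt_stereoDeriv (p : Sph n) (h : EuclideanSpace ℝ (Fin (2 * n + 1))) :
    HasFDerivAt (fun x => stereoDeriv p x h)
      (-((innerSL ℝ h).smulRight (p : Amb n))) 0 := by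
  have h1 : HasFDerivAt (fun x : EuclideanSpace ℝ (Fin (2 * n + 1)) => ‖x‖ ^ 2)
      (0 : _ →L[ℝ] ℝ) 0 := by
    have := (hasStrictFDerivAt_norm_sq (0 : EuclideanSpace ℝ (Fin (2 * n + 1)))).hasFDerivAt
    exact this.congr_fderiv (by simp)
  have hne : ‖(0 : EuclideanSpace ℝ (Fin (2 * n + 1)))‖ ^ 2 + 4 ≠ 0 := by positivity
  have h2 : HasFDerivAt (fun x : EuclideanSpace ℝ (Fin (2 * n + 1)) => (‖x‖ ^ 2 + 4)⁻¹)
      (0 : _ →L[ℝ] ℝ) 0 := by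
    have := (hasDerivAt_inv hne).comp_hasFDerivAt (0 : EuclideanSpace ℝ (Fin (2 * n + 1)))
      (h1.add_const 4)
    rw [smul_zero] at this
    exact this
  have h3 : HasFDerivAt (fun x => 2 * ⟪x, h⟫) ((2 : ℝ) • innerSL ℝ h) 0 := by
    have := ((innerSL ℝ h).hasFDerivAt (x := 0)).const_mul 2
    simpa [real_inner_comm] using this
  have h4 := (h2.fun_smul ((h3.smul_const (p : Amb n)).const_sub ((4 : ℝ) • tanIncl p h))).sub
    (((h2.pow 2).mul h3).smul (((tanIncl p).hasFDerivAt (x := 0)).const_smul (4 : ℝ) |>.add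
    ((h1.const_sub 4).smul_const (p : Amb n))))
  refine (h4 : HasFDerivAt (fun x => stereoDeriv p x h) _ 0).congr_fderiv ?_
  ext1 k
  simp
  module

/-- In the chart, `√(det g) X^i` is a power of the conformal factor times `⟪∂_i, Y⟫`. At the centre
the conformal factor is stationary and `∂_i` varies only in the normal direction, which is
orthogonal to `Y p`; hence only the derivative of `Y` contributes. -/
theorem divergence_webster (X : ∀ q : Sph n, Tan q) (Y : Amb n → Amb n)
    (hXY : ∀ q, dIncl q (X q) = Y q) (p : Sph n) (hY : DifferentiableAt ℝ Y p) :
    divergence (m := 2 * n + 1) (fun q : Sph n => webster q) X p =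
      ∑ i, ⟪tanIncl p (EuclideanSpace.single i 1),
        fderiv ℝ Y p (tanIncl p (EuclideanSpace.single i 1))⟫ := by
  have h1 : HasFDerivAt (fun x : EuclideanSpace ℝ (Fin (2 * n + 1)) => ‖x‖ ^ 2)
      (0 : _ →L[ℝ] ℝ) 0 := by
    have := (hasStrictFDerivAt_norm_sq (0 : EuclideanSpace ℝ (Fin (2 * n + 1)))).hasFDerivAt
    exact this.congr_fderiv (by simp)
  have hk : HasFDerivAt (fun x : EuclideanSpace ℝ (Fin (2 * n + 1)) =>
      (4 * (‖x‖ ^ 2 + 4)⁻¹) ^ (2 * n + 1) * ((4 * (‖x‖ ^ 2 + 4)⁻¹) ^ 2)⁻¹)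
      (0 : _ →L[ℝ] ℝ) 0 := by
    -- The scalar factor is a differentiable function of `t = ‖x‖²`, whose differential at the
    -- origin is zero.
    have hd : DifferentiableAt ℝ (fun t : ℝ =>
        (4 * (t + 4)⁻¹) ^ (2 * n + 1) * ((4 * (t + 4)⁻¹) ^ 2)⁻¹)
        (‖(0 : EuclideanSpace ℝ (Fin (2 * n + 1)))‖ ^ 2) := by
      have : DifferentiableAt ℝ (fun t : ℝ => 4 * (t + 4)⁻¹)
          (‖(0 : EuclideanSpace ℝ (Fin (2 * n + 1)))‖ ^ 2) := by
        refine ((differentiableAt_id.add_const _).inv ?_).const_mul _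
        simp
      refine (this.pow _).mul ((this.pow 2).inv ?_)
      simp
    have := hd.hasDerivAt.comp_hasFDerivAt (0 : EuclideanSpace ℝ (Fin (2 * n + 1))) h1
    rw [smul_zero] at this
    exact this
  have h0 : stereoParam p 0 = p := by simp [stereoParam]
  have hphi : HasFDerivAt (stereoParam p) (tanIncl p) 0 := by
    refine (differentiable_stereoParam p 0).hasFDerivAt.congr_fderiv ?_
    ext1 h
    rw [fderiv_stereoParam]
    simp [stereoDeriv]
  have hYphi : HasFDerivAt (fun x => Y (stereoParam p x)) ((fderiv ℝ Y p).comp (tanIncl p)) 0 := by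
    refine HasFDerivAt.comp 0 ?_ hphi
    rw [h0]
    exact hY.hasFDerivAt
  have htan : ⟪(p : Amb n), Y p⟫ = 0 := by rw [← hXY, inner_dIncl]
  rw [divergence, chartAt_self, volDensity_webster]
  simp only [norm_zero]
  -- The density at the centre is `(4 / 4) ^ (2n+1) = 1`, so the prefactor disappears.
  norm_num
  refine Finset.sum_congr rfl fun i _ => ?_
  have hfun : (fun x => volDensity (m := 2 * n + 1) (fun q : Sph n => webster q) p x *
        coordComp X p x i) = fun x =>
      ((4 * (‖x‖ ^ 2 + 4)⁻¹) ^ (2 * n + 1) * ((4 * (‖x‖ ^ 2 + 4)⁻¹) ^ 2)⁻¹) *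
        ⟪stereoDeriv p x (EuclideanSpace.single i 1), Y (stereoParam p x)⟫ := by
    funext x
    rw [volDensity_webster, coordComp_eq, hXY, coe_chartAt_symm, mul_assoc]
  rw [hfun, (hk.fun_mul ((hasFDerivAt_stereoDeriv p _).inner ℝ hYphi)).fderiv]
  simp [h0, htan, stereoDeriv]

/-- The trace of `A` is computed in the standard basis and in the orthonormal basis formed by `p`
(at `none`) and the basis of `p^⊥`. -/
theorem sum_inner_tanIncl (p : Sph n) (A : Amb n →L[ℝ] Amb n) :
    ∑ i, ⟪tanIncl p (EuclideanSpace.single i 1), A (tanIncl p (EuclideanSpace.single i 1))⟫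
      = ∑ k, A (EuclideanSpace.single k 1) k - ⟪(p : Amb n), A p⟫ := by
  have ho : Orthonormal ℝ (fun o : Option (Fin (2 * n + 1)) =>
      o.elim (p : Amb n) fun i => tanIncl p (EuclideanSpace.single i 1)) := by
    rw [orthonormal_iff_ite]
    rintro (_ | i) (_ | j)
    · simp
    · simp [inner_left_tanIncl]
    · simp [real_inner_comm, inner_left_tanIncl]
    · simp [inner_tanIncl, EuclideanSpace.inner_single_left]
  have hc : Fintype.card (Option (Fin (2 * n + 1))) = Module.finrank ℝ (Amb n) := by
    simp; ring
  let b := (basisOfOrthonormalOfCardEqFinrank ho hc).toOrthonormalBasis (by simpa using ho)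
  have hb : ∀ o, b o = o.elim (p : Amb n) fun i => tanIncl p (EuclideanSpace.single i 1) := by
    simp [b]
  have h1 := LinearMap.trace_eq_sum_inner (A : Amb n →ₗ[ℝ] Amb n) b
  have h2 := LinearMap.trace_eq_sum_inner (A : Amb n →ₗ[ℝ] Amb n) (EuclideanSpace.basisFun _ ℝ)
  rw [h1, Fintype.sum_option] at h2
  simp only [hb] at h2
  simp only [Option.elim, EuclideanSpace.basisFun_apply, EuclideanSpace.inner_single_left] at h2
  simp at h2 ⊢
  linarith

/-! ### Polynomials on the ambient space -/

theorem hasFDerivAt_eval (P : Pol n) (u : Amb n) :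
    HasFDerivAt (fun w : Amb n => MvPolynomial.eval (fun i => w i) P)
      (∑ i, MvPolynomial.eval (fun i => u i) (MvPolynomial.pderiv i P) •
        (EuclideanSpace.proj i : Amb n →L[ℝ] ℝ)) u := by
  induction P using MvPolynomial.induction_on with
  | C a => simpa using hasFDerivAt_const a u
  | add P Q hP hQ =>
    simp only [map_add, add_smul, Finset.sum_add_distrib]
    exact hP.add hQ
  | mul_X P k hP =>
    have hX : HasFDerivAt (fun w : Amb n => w k) (EuclideanSpace.proj k : Amb n →L[ℝ] ℝ) u :=
      (EuclideanSpace.proj k : Amb n →L[ℝ] ℝ).hasFDerivAt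
    have h := hP.fun_mul hX
    simp only [map_mul, MvPolynomial.eval_X]
    refine h.congr_fderiv ?_
    have hk : ∀ i, MvPolynomial.eval (fun i => u i) (MvPolynomial.pderiv i (P * MvPolynomial.X k))
        = MvPolynomial.eval (fun i => u i) P * (if k = i then 1 else 0)
          + u k * MvPolynomial.eval (fun i => u i) (MvPolynomial.pderiv i P) := fun i => by
      simp [Derivation.leibniz, MvPolynomial.pderiv_X, Pi.single_apply, apply_ite]
    simp only [hk, add_smul, Finset.sum_add_distrib, mul_smul, ← Finset.smul_sum, ite_smul,
      one_smul, zero_smul, Finset.sum_ite_eq, Finset.mem_univ, if_true]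

theorem fderiv_eval (P : Pol n) (u v : Amb n) :
    fderiv ℝ (fun w : Amb n => MvPolynomial.eval (fun i => w i) P) u v
      = ∑ i, MvPolynomial.eval (fun i => u i) (MvPolynomial.pderiv i P) * v i := by
  rw [(hasFDerivAt_eval P u).fderiv]
  simp

theorem contDiff_eval (P : Pol n) {k : ℕ∞ω} :
    ContDiff ℝ k (fun w : Amb n => MvPolynomial.eval (fun i => w i) P) := by
  induction P using MvPolynomial.induction_on with
  | C a => simpa using contDiff_const
  | add P Q hP hQ => simpa using hP.add hQ
  | mul_X P i hP =>
    have hX : ContDiff ℝ k (fun w : Amb n => w i) :=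
      (EuclideanSpace.proj i : Amb n →L[ℝ] ℝ).contDiff
    simpa using hP.mul hX

theorem contMDiff_restrict (P : Pol n) :
    ContMDiff (𝓡 (2 * n + 1)) 𝓘(ℝ, ℝ) ∞ (restrict P : Sph n → ℝ) :=
  (contDiff_eval P).contMDiff.comp contMDiff_coe_sphere

/-- The polynomial vector field with components `Q`. -/
def polField (Q : Fin (n + 1) ⊕ Fin (n + 1) → Pol n) (u : Amb n) : Amb n :=
  WithLp.toLp 2 fun k => MvPolynomial.eval (fun i => u i) (Q k)

theorem fderiv_polField_apply (Q : Fin (n + 1) ⊕ Fin (n + 1) → Pol n) (u : Amb n) :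
    DifferentiableAt ℝ (polField Q) u ∧ ∀ v k, fderiv ℝ (polField Q) u v k =
      ∑ i, MvPolynomial.eval (fun i => u i) (MvPolynomial.pderiv i (Q k)) * v i := by
  have hd : DifferentiableAt ℝ (polField Q) u :=
    (differentiableAt_euclidean (𝕜 := ℝ)).2 fun k => (hasFDerivAt_eval (Q k) u).differentiableAt
  refine ⟨hd, fun v k => ?_⟩
  have h := ((EuclideanSpace.proj k : Amb n →L[ℝ] ℝ).hasFDerivAt.comp u hd.hasFDerivAt)
  rw [← fderiv_eval]
  exact (DFunLike.congr_fun h.fderiv v).symm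

/-- The components of multiplication by `i`, as polynomials. -/
def polJ (n : ℕ) : Fin (n + 1) ⊕ Fin (n + 1) → Pol n :=
  Sum.elim (fun j => -MvPolynomial.X (Sum.inr j)) (fun j => MvPolynomial.X (Sum.inl j))

theorem eval_polJ (u : Amb n) (k : Fin (n + 1) ⊕ Fin (n + 1)) :
    MvPolynomial.eval (fun i => u i) (polJ n k) = ambJ n u k := by
  rcases k with k | k
  · simp [polJ, ambJ_inl]
  · simp [polJ, ambJ_inr]

theorem T₀_eq (P : Pol n) : T₀ n P = ∑ k, polJ n k * MvPolynomial.pderiv k P := by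
  simp only [T₀, polJ, Fintype.sum_sum_type, LinearMap.sum_apply, ← Finset.sum_add_distrib]
  refine Finset.sum_congr rfl fun j _ => ?_
  simp
  ring

theorem T₀_mul (P Q : Pol n) : T₀ n (P * Q) = T₀ n P * Q + P * T₀ n Q := by
  simp only [T₀_eq, Finset.sum_mul, Finset.mul_sum, ← Finset.sum_add_distrib,
    Derivation.leibniz, smul_eq_mul]
  exact Finset.sum_congr rfl fun k _ => by ring

theorem T₀_X (k : Fin (n + 1) ⊕ Fin (n + 1)) : T₀ n (MvPolynomial.X k) = polJ n k := by
  simp [T₀_eq, MvPolynomial.pderiv_X, Pi.single_apply]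

theorem polLaplacian_eq (P : Pol n) :
    polLaplacian n P = ∑ k, MvPolynomial.pderiv k (MvPolynomial.pderiv k P) := by
  simp [polLaplacian]

/-- This recursion lets `simp` evaluate the Laplacian of explicit products of variables. -/
theorem polLaplacian_mul_X (P : Pol n) (k : Fin (n + 1) ⊕ Fin (n + 1)) :
    polLaplacian n (P * MvPolynomial.X k)
      = polLaplacian n P * MvPolynomial.X k + 2 * MvPolynomial.pderiv k P := by
  have h : ∀ i, MvPolynomial.pderiv i (MvPolynomial.pderiv i (P * MvPolynomial.X k)) =
      MvPolynomial.pderiv i (MvPolynomial.pderiv i P) * MvPolynomial.X k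
        + if k = i then 2 * MvPolynomial.pderiv i P else 0 := by
    intro i
    by_cases hik : k = i
    · subst hik
      simp [Derivation.leibniz]
      ring
    · simp [Derivation.leibniz, hik, MvPolynomial.pderiv_X_of_ne hik]
      ring
  simp only [polLaplacian_eq, h, Finset.sum_add_distrib, ← Finset.sum_mul]
  simp

theorem sum_eval_X_mul_pderiv {P : Pol n} {ℓ : ℕ} (hP : P.IsHomogeneous ℓ) (u : Amb n) :
    ∑ k, u k * MvPolynomial.eval (fun i => u i) (MvPolynomial.pderiv k P)
      = ℓ * MvPolynomial.eval (fun i => u i) P := by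
  have h := congrArg (MvPolynomial.eval (fun i => u i)) hP.sum_X_mul_pderiv
  simpa using h

/-! ### The horizontal gradient of a homogeneous polynomial -/

/-- A polynomial vector field on `ℂ^{n+1}` extending the horizontal gradient of the restriction
of the homogeneous polynomial `P` of degree `ℓ`. -/
def polGradH (P : Pol n) (ℓ : ℕ) (k : Fin (n + 1) ⊕ Fin (n + 1)) : Pol n :=
  MvPolynomial.pderiv k P - (ℓ : Pol n) * (P * MvPolynomial.X k) - T₀ n P * polJ n k

theorem inner_eq_sum (u v : Amb n) : ⟪u, v⟫ = ∑ k, u k * v k := by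
  simp [PiLp.inner_apply, mul_comm]

theorem dIncl_grad_restrict {P : Pol n} {ℓ : ℕ} (hP : P.IsHomogeneous ℓ) (q : Sph n) :
    dIncl q (grad (restrict P) q) =
      polField (fun k => MvPolynomial.pderiv k P) q - (ℓ * restrict P q) • (q : Amb n) := by
  set g := polField (fun k => MvPolynomial.pderiv k P) (q : Amb n) with hg
  have hqg : ⟪(q : Amb n), g⟫ = ℓ * restrict P q := by
    rw [inner_eq_sum]
    exact sum_eval_X_mul_pderiv hP _
  have ht : g - (ℓ * restrict P q) • (q : Amb n) ∈ LinearMap.range (dIncl q) := by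
    rw [mem_range_dIncl, inner_sub_right, hqg, inner_smul_right, inner_self_sph, mul_one, sub_self]
  obtain ⟨w, hw⟩ := ht
  -- The difference is itself tangent, so being orthogonal to every tangent vector forces it to
  -- vanish.
  have key : ∀ v, ⟪dIncl q (grad (restrict P) q - w), dIncl q v⟫ = 0 := by
    intro v
    have h1 := webster_grad (restrict P) q v
    rw [webster_eq, show dFun (restrict P) q v = _ from
      dFun_restrict_comp q (hasFDerivAt_eval P q).differentiableAt v, fderiv_eval] at h1
    have h2 : ⟪g, dIncl q v⟫ =
        ∑ i, MvPolynomial.eval (fun i => (q : Amb n) i) (MvPolynomial.pderiv i P) * dIncl q v i :=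
      inner_eq_sum _ _
    rw [map_sub, inner_sub_left, h1, hw, inner_sub_left, h2, real_inner_smul_left, inner_dIncl]
    ring
  have h3 := inner_self_eq_zero.1 (key _)
  rw [map_sub, sub_eq_zero, hw] at h3
  exact h3

theorem dIncl_gradH_restrict {P : Pol n} {ℓ : ℕ} (hP : P.IsHomogeneous ℓ) (q : Sph n) :
    dIncl q (gradH (restrict P) q) = polField (polGradH P ℓ) q := by
  have hT : ⟪ambJ n q, polField (fun k => MvPolynomial.pderiv k P) (q : Amb n)⟫
      = MvPolynomial.eval (fun i => (q : Amb n) i) (T₀ n P) := by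
    rw [inner_eq_sum, T₀_eq]
    simp [eval_polJ, polField]
  have h : dIncl q (gradH (restrict P) q) = dIncl q (grad (restrict P) q)
      - theta q (grad (restrict P) q) • ambJ n q := by
    rw [gradH, projH, map_sub, map_smul, dIncl_reeb]
  rw [h, theta_eq, dIncl_grad_restrict hP, inner_sub_right, inner_smul_right, inner_ambJ_self, hT]
  ext k
  simp [polField, polGradH, eval_polJ, restrict]
  ring

theorem sum_pderiv_polGradH {P : Pol n} {ℓ : ℕ} (hP : P.IsHomogeneous ℓ) :
    ∑ k, MvPolynomial.pderiv k (polGradH P ℓ k) =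
      polLaplacian n P - (ℓ * (ℓ + 2 * n + 2) : Pol n) * P - T₀ n (T₀ n P) := by
  -- The field `Jz` is divergence free: its `k`-th component does not involve the `k`-th variable.
  have hJ : ∀ k, MvPolynomial.pderiv k (polJ n k) = 0 := by
    rintro (k | k) <;> simp [polJ]
  have hE := hP.sum_X_mul_pderiv
  have hk : ∀ k, MvPolynomial.pderiv k (polGradH P ℓ k) =
      MvPolynomial.pderiv k (MvPolynomial.pderiv k P)
        - (ℓ : Pol n) * (P + MvPolynomial.X k * MvPolynomial.pderiv k P)
        - polJ n k * MvPolynomial.pderiv k (T₀ n P) := by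
    intro k
    simp only [polGradH, map_sub, Derivation.leibniz, hJ, MvPolynomial.pderiv_X_self,
      Derivation.map_natCast, smul_eq_mul]
    ring
  rw [polLaplacian_eq, T₀_eq (T₀ n P)]
  simp only [hk, Finset.sum_sub_distrib, ← Finset.mul_sum, Finset.sum_add_distrib, hE]
  simp
  ring

/-- This is the normal term `⟪p, DY(p) p⟫`. With `E` the Euler derivation and `N = |z|²`, one has
`⟪z, Y⟫ = ℓP(1 - N)`; applying `E` and then setting `N = 1` gives the value. -/
theorem eval_sum_X_mul_polGradH {P : Pol n} {ℓ : ℕ} (hP : P.IsHomogeneous ℓ) (p : Sph n) :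
    ∑ k, (p : Amb n) k * ∑ i, MvPolynomial.eval (fun i => (p : Amb n) i)
      (MvPolynomial.pderiv i (polGradH P ℓ k)) * (p : Amb n) i = -(2 * ℓ * restrict P p) := by
  let E : Derivation ℝ (Pol n) (Pol n) := ∑ i, (MvPolynomial.X i : Pol n) • MvPolynomial.pderiv i
  have hE : ∀ Q, E Q = ∑ i, MvPolynomial.X i * MvPolynomial.pderiv i Q := fun Q => by
    have h := map_sum (Derivation.coeFnAddMonoidHom (R := ℝ) (A := Pol n) (M := Pol n))
      (fun i => (MvPolynomial.X i : Pol n) • MvPolynomial.pderiv i) Finset.univ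
    exact (congrFun h Q).trans (by simp [Derivation.coeFnAddMonoidHom])
  have hEP : E P = (ℓ : Pol n) * P := by
    rw [hE, hP.sum_X_mul_pderiv, nsmul_eq_mul]
  have hEX : ∀ k, E (MvPolynomial.X k) = MvPolynomial.X k := fun k => by
    simp [hE, MvPolynomial.pderiv_X, Pi.single_apply]
  have hXJ : ∑ k, (MvPolynomial.X k : Pol n) * polJ n k = 0 := by
    simp [Fintype.sum_sum_type, polJ, mul_comm]
  set N : Pol n := ∑ k, MvPolynomial.X k * MvPolynomial.X k with hN
  have hEN : E N = 2 * N := by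
    simp only [hN, map_sum, Derivation.leibniz, hEX, smul_eq_mul, Finset.mul_sum, two_mul,
      Finset.sum_add_distrib]
  have hQ : ∑ k, MvPolynomial.X k * polGradH P ℓ k = (ℓ : Pol n) * P - (ℓ : Pol n) * (P * N) := by
    have : ∀ k, (MvPolynomial.X k : Pol n) * polGradH P ℓ k =
        MvPolynomial.X k * MvPolynomial.pderiv k P
          - (ℓ : Pol n) * (P * (MvPolynomial.X k * MvPolynomial.X k))
          - T₀ n P * (MvPolynomial.X k * polJ n k) := fun k => by
      rw [polGradH]; ring
    simp only [this, Finset.sum_sub_distrib, ← Finset.mul_sum, hXJ, hP.sum_X_mul_pderiv]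
    simp [hN]
  have h2 := congrArg E hQ
  simp only [map_sum, map_sub, Derivation.leibniz, hEX, hEP, hEN, smul_eq_mul,
    Finset.sum_add_distrib, Derivation.map_natCast] at h2
  -- The other Leibniz term is `⟪z, Y⟫` again, which is zero where `N = 1`.
  have h3 : ∑ k, polGradH P ℓ k * MvPolynomial.X k = _ :=
    (Finset.sum_congr rfl fun k _ => mul_comm _ _).trans hQ
  rw [h3] at h2
  have h4 := congrArg (MvPolynomial.eval (fun i => (p : Amb n) i)) h2
  have hN1 : MvPolynomial.eval (fun i => (p : Amb n) i) N = 1 := by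
    have h := inner_self_sph p
    rw [inner_eq_sum] at h
    simpa [hN] using h
  simp only [map_add, map_sub, map_mul, map_sum, hN1, hE, MvPolynomial.eval_X, map_natCast,
    map_ofNat, mul_zero, add_zero] at h4
  have h5 : ∀ k, ∑ i, MvPolynomial.eval (fun i => (p : Amb n) i)
      (MvPolynomial.pderiv i (polGradH P ℓ k)) * (p : Amb n) i =
      ∑ i, (p : Amb n) i * MvPolynomial.eval (fun i => (p : Amb n) i)
      (MvPolynomial.pderiv i (polGradH P ℓ k)) := fun k =>
    Finset.sum_congr rfl fun i _ => mul_comm _ _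
  simp only [h5, restrict]
  linarith

/-- On restrictions of harmonic homogeneous polynomials in `Ker(T₀² + lam I)`, the sublaplacian is
multiplication by `lam - ℓ (2n + ℓ)`. -/
theorem sublaplacian_restrict {P : Pol n} {ℓ : ℕ} {lam : ℝ} (hP : P ∈ harmPol n ℓ)
    (hT : P ∈ LinearMap.ker (T₀ n ^ 2 + lam • (1 : Module.End ℝ (Pol n)))) (p : Sph n) :
    sublaplacian n (restrict P) p = (lam - ℓ * (2 * n + ℓ)) * restrict P p := by
  obtain ⟨hP, hL⟩ := hP
  have hP : P.IsHomogeneous ℓ := hP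
  have hT : T₀ n (T₀ n P) = -(lam • P) := by
    rw [← add_eq_zero_iff_eq_neg]
    simpa [pow_two] using hT
  have hd := fderiv_polField_apply (polGradH P ℓ) p
  rw [sublaplacian, divergence_webster _ _ (dIncl_gradH_restrict hP) p hd.1, sum_inner_tanIncl,
    inner_eq_sum]
  simp only [hd.2]
  -- Subtracting the normal term adds `2ℓP`, turning `ℓ(ℓ + 2n + 2)` into `ℓ(ℓ + 2n)`.
  rw [eval_sum_X_mul_polGradH hP]
  have h1 := congrArg (MvPolynomial.eval (fun i => (p : Amb n) i)) (sum_pderiv_polGradH hP)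
  rw [hT, LinearMap.mem_ker.1 hL] at h1
  simp only [map_sum, map_sub, map_mul, map_neg, map_add, MvPolynomial.smul_eval, map_natCast,
    map_ofNat, map_zero] at h1
  simp [restrict, h1]
  ring

/-! ### Eigenvalues -/

theorem eval_smul_of_isHomogeneous {σ : Type*} [Fintype σ] {P : MvPolynomial σ ℝ} {ℓ : ℕ}
    (hP : P.IsHomogeneous ℓ) (c : ℝ) (x : σ → ℝ) :
    MvPolynomial.eval (c • x) P = c ^ ℓ * MvPolynomial.eval x P := by
  rw [MvPolynomial.eval_eq', MvPolynomial.eval_eq', Finset.mul_sum]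
  refine Finset.sum_congr rfl fun d hd => ?_
  have hd' : ∑ i, d i = ℓ := by
    have := hP (MvPolynomial.mem_support_iff.1 hd)
    simpa [Finsupp.weight_apply, Finsupp.sum_fintype] using this
  simp only [Pi.smul_apply, smul_eq_mul, mul_pow, Finset.prod_mul_distrib,
    Finset.prod_pow_eq_pow_sum, hd']
  ring

/-- By homogeneity, vanishing on the sphere spreads along rays to every nonzero point. -/
theorem restrict_ne_zero {P : Pol n} {ℓ : ℕ} (hP : P.IsHomogeneous ℓ) (h0 : P ≠ 0) :
    (restrict P : Sph n → ℝ) ≠ 0 := by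
  intro h
  -- The factor `X` takes care of the origin, which no ray from the sphere reaches by rescaling.
  have hz : P * MvPolynomial.X (Sum.inl 0) = 0 := by
    refine MvPolynomial.funext fun x => ?_
    rw [map_mul, map_zero, MvPolynomial.eval_X]
    let u : Amb n := WithLp.toLp 2 x
    by_cases hu : u = 0
    · have : x (Sum.inl 0) = 0 := congrFun (congrArg WithLp.ofLp hu) _
      rw [this, mul_zero]
    · have hp : ‖u‖⁻¹ • u ∈ sphere (0 : Amb n) 1 := by
        simp [norm_smul, hu]
      have h1 := congrFun h ⟨_, hp⟩
      have hx : x = ‖u‖ • fun i => (‖u‖⁻¹ • u) i := by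
        funext i
        have : ‖u‖ ≠ 0 := norm_ne_zero_iff.2 hu
        simp [u, this]
      have h2 : MvPolynomial.eval x P = 0 := by
        rw [hx, eval_smul_of_isHomogeneous hP, show MvPolynomial.eval _ P = 0 from h1, mul_zero]
      rw [h2, zero_mul]
  exact (mul_ne_zero h0 (MvPolynomial.X_ne_zero _)) hz

theorem restrict_mem_eigen {P : Pol n} {ℓ : ℕ} {lam μ : ℝ} (hP : P ∈ harmPol n ℓ)
    (hT : T₀ n (T₀ n P) = -(lam • P)) (hμ : μ = lam - ℓ * (2 * n + ℓ)) :
    restrict P ∈ eigen n μ := by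
  refine ⟨contMDiff_restrict P, fun p => ?_⟩
  rw [hμ]
  refine sublaplacian_restrict hP ?_ p
  simp [pow_two, hT]

theorem exists_eigenfunction {P : Pol n} {ℓ : ℕ} {lam μ : ℝ} (hP : P.IsHomogeneous ℓ)
    (hL : polLaplacian n P = 0) (h0 : P ≠ 0) (hT : T₀ n (T₀ n P) = -(lam • P))
    (hμ : μ = lam - ℓ * (2 * n + ℓ)) :
    ∃ H ∈ homPol n ℓ, restrict H ≠ 0 ∧ restrict H ∈ eigen n μ :=
  ⟨P, hP, restrict_ne_zero hP h0, restrict_mem_eigen ⟨hP, hL⟩ hT hμ⟩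

/-! ### Explicit eigenfunctions of degrees 1, 2 and 3 -/

theorem exists_eigenfunction_one (n : ℕ) :
    ∃ H ∈ homPol n 1, restrict H ≠ 0 ∧ restrict H ∈ eigen n (-2 * (n : ℝ)) := by
  refine exists_eigenfunction (P := MvPolynomial.X (Sum.inl 0)) (lam := 1)
    (MvPolynomial.isHomogeneous_X _ _) ?_ (MvPolynomial.X_ne_zero _) ?_ ?_
  · simpa [polLaplacian_eq] using polLaplacian_mul_X (1 : Pol n) (Sum.inl 0)
  · simp [T₀_X, polJ]
  · push_cast; ring

theorem exists_eigenfunction_two (n : ℕ) :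
    ∃ H ∈ homPol n 2, restrict H ≠ 0 ∧ restrict H ∈ eigen n (-4 * (n : ℝ)) := by
  have hX := fun k => MvPolynomial.isHomogeneous_X ℝ (k : Fin (n + 1) ⊕ Fin (n + 1))
  have hl : ∀ k, polLaplacian n (MvPolynomial.X k) = 0 := fun k => by
    simpa [polLaplacian_eq] using polLaplacian_mul_X (1 : Pol n) k
  -- The real part of `z²`, with `z` the first complex coordinate; `4 = 2²`.
  refine exists_eigenfunction (lam := 4) (P := MvPolynomial.X (Sum.inl 0) * MvPolynomial.X (Sum.inl 0)
    - MvPolynomial.X (Sum.inr 0) * MvPolynomial.X (Sum.inr 0))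
    (((hX _).mul (hX _)).sub ((hX _).mul (hX _))) ?_ ?_ ?_ ?_
  · simp [polLaplacian_mul_X, hl]
  · intro h
    have := congrArg (MvPolynomial.eval (Sum.elim (Pi.single 0 1) 0)) h
    simp at this
  · simp [T₀_X, T₀_mul, polJ]
    simp only [Algebra.smul_def, map_ofNat]
    ring
  · push_cast; ring

theorem exists_eigenfunction_three (n : ℕ) :
    ∃ H ∈ homPol n 3, restrict H ≠ 0 ∧ restrict H ∈ eigen n (-6 * (n : ℝ)) := by
  have hX := fun k => MvPolynomial.isHomogeneous_X ℝ (k : Fin (n + 1) ⊕ Fin (n + 1))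
  have hl : ∀ k, polLaplacian n (MvPolynomial.X k) = 0 := fun k => by
    simpa [polLaplacian_eq] using polLaplacian_mul_X (1 : Pol n) k
  let x : Pol n := MvPolynomial.X (Sum.inl 0)
  let y : Pol n := MvPolynomial.X (Sum.inr 0)
  -- The real part of `z³`; `9 = 3²`.
  refine exists_eigenfunction (lam := 9) (P := x * x * x - (3 : ℝ) • (x * y * y))
    ((((hX _).mul (hX _)).mul (hX _)).sub
      (Submodule.smul_mem (homPol n 3) 3 (((hX _).mul (hX _)).mul (hX _)))) ?_ ?_ ?_ ?_
  · simp [x, y, polLaplacian_mul_X, hl]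
    simp only [Algebra.smul_def, map_ofNat]
    ring
  · intro h
    have := congrArg (MvPolynomial.eval (Sum.elim (Pi.single 0 1) 0)) h
    simp [x, y] at this
  · simp [x, y, T₀_X, T₀_mul, polJ]
    simp only [Algebra.smul_def, map_ofNat]
    ring
  · push_cast; ring

theorem exists_eigenfunction_three' {n : ℕ} (hn : 1 ≤ n) :
    ∃ H ∈ homPol n 3, restrict H ≠ 0 ∧ restrict H ∈ eigen n (-6 * (n : ℝ) - 8) := by
  have hX := fun k => MvPolynomial.isHomogeneous_X ℝ (k : Fin (n + 1) ⊕ Fin (n + 1))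
  have hl : ∀ k, polLaplacian n (MvPolynomial.X k) = 0 := fun k => by
    simpa [polLaplacian_eq] using polLaplacian_mul_X (1 : Pol n) k
  -- Here `1 ≤ n` provides a second complex coordinate; for `w = z` the polynomial `Re (z² w̄)`
  -- would not be harmonic.
  have h01 : Fin.last n ≠ 0 := by
    rw [Ne, Fin.ext_iff, Fin.val_last, Fin.val_zero]; omega
  let x : Pol n := MvPolynomial.X (Sum.inl 0)
  let y : Pol n := MvPolynomial.X (Sum.inr 0)
  let x' : Pol n := MvPolynomial.X (Sum.inl (Fin.last n))
  let y' : Pol n := MvPolynomial.X (Sum.inr (Fin.last n))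
  -- The real part of `z² w̄`; `1 = (2 - 1)²`.
  refine exists_eigenfunction (lam := 1)
    (P := x * x * x' - y * y * x' + (2 : ℝ) • (x * y * y'))
    (((((hX _).mul (hX _)).mul (hX _)).sub (((hX _).mul (hX _)).mul (hX _))).add
      (Submodule.smul_mem (homPol n 3) 2 (((hX _).mul (hX _)).mul (hX _)))) ?_ ?_ ?_ ?_
  · simp [x, y, x', y', polLaplacian_mul_X, hl, h01.symm]
  · intro h
    have := congrArg (MvPolynomial.eval (Sum.elim 1 0)) h
    simp [x, y, x', y'] at this
  · simp [x, y, x', y', T₀_X, T₀_mul, polJ]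
    simp only [Algebra.smul_def, map_ofNat]
    ring
  · push_cast; ring

end CRSphere

end

/-- If some nonzero harmonic homogeneous polynomial of degree `ℓ` lies in `Ker(T₀² + lam I)`, then
`lam - ℓ (2n + ℓ)` is an eigenvalue of the sublaplacian of `S^{2n+1}`. In particular `-2n`, `-4n`,
`-6n-8` and `-6n` are eigenvalues, with eigenfunctions that are restrictions of homogeneous
polynomials of degree `1`, `2`, `3` and `3`. -/
theorem mainTheorem5 (n : ℕ) (hn : 1 ≤ n) :
    (∀ (ℓ : ℕ) (lam : ℝ),
      CRSphere.harmPol n ℓ ⊓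
          LinearMap.ker (CRSphere.T₀ n ^ 2 + lam • (1 : Module.End ℝ (CRSphere.Pol n))) ≠ ⊥ →
        lam - (ℓ : ℝ) * (2 * (n : ℝ) + (ℓ : ℝ)) ∈ CRSphere.spec n) ∧
    ({-2 * (n : ℝ), -4 * (n : ℝ), -6 * (n : ℝ) - 8, -6 * (n : ℝ)} : Set ℝ) ⊆ CRSphere.spec n ∧
    (∃ H ∈ CRSphere.homPol n 1, CRSphere.restrict H ≠ 0 ∧
      CRSphere.restrict H ∈ CRSphere.eigen n (-2 * (n : ℝ))) ∧
    (∃ H ∈ CRSphere.homPol n 2, CRSphere.restrict H ≠ 0 ∧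
      CRSphere.restrict H ∈ CRSphere.eigen n (-4 * (n : ℝ))) ∧
    (∀ μ ∈ ({-6 * (n : ℝ) - 8, -6 * (n : ℝ)} : Set ℝ),
      ∃ H ∈ CRSphere.homPol n 3, CRSphere.restrict H ≠ 0 ∧
        CRSphere.restrict H ∈ CRSphere.eigen n μ) := by
  have h1 := CRSphere.exists_eigenfunction_one n
  have h2 := CRSphere.exists_eigenfunction_two n
  have h3 := CRSphere.exists_eigenfunction_three' hn
  have h4 := CRSphere.exists_eigenfunction_three n
  have hs : ∀ {ℓ : ℕ} {μ : ℝ}, (∃ H ∈ CRSphere.homPol n ℓ, CRSphere.restrict H ≠ 0 ∧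
      CRSphere.restrict H ∈ CRSphere.eigen n μ) → μ ∈ CRSphere.spec n :=
    fun ⟨H, _, h0, hH⟩ => ⟨_, hH, h0⟩
  refine ⟨fun ℓ lam h => ?_, ?_, h1, h2, ?_⟩
  · obtain ⟨P, ⟨hP, hT⟩, h0⟩ := Submodule.exists_mem_ne_zero_of_ne_bot h
    exact ⟨_, ⟨CRSphere.contMDiff_restrict P, CRSphere.sublaplacian_restrict hP hT⟩,
      CRSphere.restrict_ne_zero hP.1 h0⟩
  · rintro μ (rfl | rfl | rfl | rfl)
    exacts [hs h1, hs h2, hs h3, hs h4]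
  · rintro μ (rfl | rfl)
    exacts [h3, h4]
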